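/- Fix an integer $d\ge 1$. A decorated graph $(\Gamma,n)$ consists of a finite directed graph $\Gamma$ with totally ordered vertex set $\Gamma_0$, totally ordered edge set $\Gamma_1$, and tail and head maps $t,h:\Gamma_1\to\Gamma_0$ (multiple edges, self-loops and disconnected graphs are allowed), together with a map $n:\Gamma_1\to(\mathbb{Z}_{\ge 0})^d$, $e\mapsto (n_{1,e},\dots,n_{d,e})$. For $t>0$ let $$H(t,z,\bar z)=\frac{1}{(2\pi t)^d}\,e^{-\frac{1}{2t}\sum_{i=1}^d z^i\bar z^i}\;d\bar z^1\wedge\cdots\wedge d\bar z^d$$ be the heat kernel on $\mathbb{C}^d$, let $\bar\partial^*=-2\sum_{i=1}^d\frac{\partial}{\partial z^i}\,\iota_{\partial/\partial\bar z^i}$, and for $\varepsilon,L>0$ let $$\tilde P_{\varepsilon,L}(z-w,\bar z-\bar w)=\int_\varepsilon^L\bar\partial_z^*H(t,z-w,\bar z-\bar w)\,dt .$$ For a decorated graph $(\Gamma,n)$ and a smooth compactly supported complex-valued differential form $\Phi\in\Omega_c^{*,*}((\mathbb{C}^d)^{|\Gamma_0|})$ put $$W_\varepsilon^L((\Gamma,n),\Phi)=(-1)^{\frac{d-1}{2}|\Gamma_1|(|\Gamma_1|-1)+|\Gamma_1|}\int_{(\mathbb{C}^d)^{|\Gamma_0|}}\prod_{e\in\Gamma_1}\partial_{z_{h(e)}}^{n(e)}\tilde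 P_{\varepsilon,L}(z_{h(e)}-z_{t(e)},\bar z_{h(e)}-\bar z_{t(e)})\wedge\Phi ,$$ where $\partial_{z_{h(e)}}^{n(e)}=\partial_{z^1_{h(e)}}^{n_{1,e}}\cdots\partial_{z^d_{h(e)}}^{n_{d,e}}$, the wedge product is taken in the order of the edges, and $(\mathbb{C}^d)^{|\Gamma_0|}$ carries its complex orientation; for a self-loop the edge factor is $0$. One says that $W_0^L((\Gamma,n),\Phi)$ exists if $\lim_{\varepsilon\to0^+}W_\varepsilon^L((\Gamma,n),\Phi)$ exists in $\mathbb{C}$, and that $W_0^{+\infty}((\Gamma,n),\Phi)$ exists if the double limit $\lim_{\varepsilon\to0^+,\,L\to+\infty}W_\varepsilon^L((\Gamma,n),\Phi)$ (as $(\varepsilon,L)\to(0,+\infty)$ jointly) exists in $\mathbb{C}$. **Proposition.** Let $L>0$. If $W_0^L((\Gamma,n),\Phi)$ exists for every decorated graph $(\Gamma,n)$ and every $\Phi\in\Omega_c^{*,*}((\mathbb{C}^d)^{|\Gamma_0|})$, then $W_0^{+\infty}((\Gamma,n),\Phi)$ exists for every decorated graph $(\Gamma,n)$ and every $\Phi\in\Omega_c^{*,*}((\mathbb{C}^d)^{|\Gamma_0|})$.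 -/

import Mathlib

open Filter Topology MeasureTheory
open scoped ContDiff ComplexConjugate

noncomputable section

namespace FeynmanGraph

/-! ### Complex-valued differential forms on a finite-dimensional real vector space -/

/-- The complexified cotangent space of the vector space `E` (at any of its points): the complex
vector space of real-linear maps `E → ℂ`. -/
abbrev Cotangent (E : Type*) [AddCommGroup E] [Module ℝ E] : Type _ := E →ₗ[ℝ] ℂ

/-- The exterior algebra of the complexified cotangent space; its product is the wedge product. -/
abbrev Ext (E : Type*) [AddCommGroup E] [Module ℝ E] : Type _ :=
  ExteriorAlgebra ℂ (Cotangent E)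

/-- A (not necessarily smooth, not necessarily homogeneous) complex differential form on `E`,
in the trivialisation of the cotangent bundle given by translations. -/
abbrev Form (E : Type*) [AddCommGroup E] [Module ℝ E] : Type _ := E → Ext E

instance instFiniteCotangent (E : Type*) [AddCommGroup E] [Module ℝ E] [Module.Finite ℝ E] :
    Module.Finite ℂ (Cotangent E) :=
  Module.Finite.of_restrictScalars_finite ℝ ℂ (Cotangent E)

instance instFiniteExt (E : Type*) [AddCommGroup E] [Module ℝ E] [Module.Finite ℝ E] :
    Module.Finite ℂ (Ext E) := by
  classical
  exact Module.Finite.of_basis (Module.finBasis ℂ (Cotangent E)).ExteriorAlgebra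

/-- A form is smooth if all its coefficients with respect to constant-coefficient forms, that is
all `ℓ ∘ α` with `ℓ` a linear functional on the exterior algebra, are smooth functions. -/
def SmoothForm {E : Type*} [NormedAddCommGroup E] [NormedSpace ℝ E] (α : Form E) : Prop :=
  ∀ ℓ : Ext E →ₗ[ℂ] ℂ, ContDiff ℝ ∞ fun p => ℓ (α p)

/-- `Ω_c^{*,*}(E)`: smooth compactly supported forms. -/
def IsTestForm {E : Type*} [NormedAddCommGroup E] [NormedSpace ℝ E] (α : Form E) : Prop :=
  SmoothForm α ∧ HasCompactSupport α

/-- Pull-back of forms along a linear map. -/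
def pullback {E F : Type*} [AddCommGroup E] [Module ℝ E] [AddCommGroup F] [Module ℝ F]
    (f : E →ₗ[ℝ] F) (α : Form F) : Form E :=
  fun p => ExteriorAlgebra.map (LinearMap.lcomp ℂ ℂ f) (α (f p))

/-- Apply a linear scalar-valued operation `T` on functions `X → ℂ` (such as a derivative at a
point, or an integral) to a function with values in a finite-dimensional space, coefficient by
coefficient. -/
def coeffwise {X M : Type*} [AddCommGroup M] [Module ℂ M] [Module.Finite ℂ M]
    (T : (X → ℂ) → ℂ) (α : X → M) : M :=
  ∑ k, T (fun x => (Module.finBasis ℂ M).repr (α x) k) • Module.finBasis ℂ M k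

/-! ### Forms on `ℂ^d` -/

/-- The affine space `ℂ^d`. -/
abbrev Cd (d : ℕ) : Type := Fin d → ℂ

/-- The one-form `d z̄^i` on `ℂ^d`. -/
def dzbar {d : ℕ} (i : Fin d) : Cotangent (Cd d) where
  toFun z := conj (z i)
  map_add' z w := by simp
  map_smul' r z := by simp

/-- The top antiholomorphic form `d^d z̄ = d z̄^1 ∧ … ∧ d z̄^d`. -/
def ddzbar (d : ℕ) : Ext (Cd d) :=
  (List.ofFn fun i : Fin d => ExteriorAlgebra.ι ℂ (dzbar i)).prod

/-- The holomorphic derivative `∂f/∂z^i = (∂f/∂x^i - √-1 ∂f/∂y^i) / 2` at the point `z`. -/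
def partialZ {d : ℕ} (i : Fin d) (z : Cd d) (f : Cd d → ℂ) : ℂ :=
  (lineDeriv ℝ f z (Pi.single i 1) - Complex.I * lineDeriv ℝ f z (Pi.single i Complex.I)) / 2

/-- The operator `∂/∂z^i` on forms, acting on coefficients. -/
def formPartialZ {d : ℕ} (i : Fin d) (α : Form (Cd d)) : Form (Cd d) :=
  fun z => coeffwise (partialZ i z) α

/-- The operator `∂_{z^1}^{n_1} ⋯ ∂_{z^d}^{n_d}` on forms. -/
def formMultiPartialZ {d : ℕ} (n : Fin d → ℕ) (α : Form (Cd d)) : Form (Cd d) :=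
  (List.finRange d).foldr (fun i η => (formPartialZ i)^[n i] η) α

/-- The complex tangent vector `∂/∂z̄^i = (∂/∂x^i + √-1 ∂/∂y^i) / 2`, as a functional on the
complexified cotangent space. -/
def vecDzbar {d : ℕ} (i : Fin d) : Module.Dual ℂ (Cotangent (Cd d)) where
  toFun l := (l (Pi.single i 1) + Complex.I * l (Pi.single i Complex.I)) / 2
  map_add' l m := by simp only [LinearMap.add_apply]; ring
  map_smul' c l := by simp only [LinearMap.smul_apply, smul_eq_mul, RingHom.id_apply]; ring

/-- The interior product with `∂/∂z̄^i`. -/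
def contractZbar {d : ℕ} (i : Fin d) : Ext (Cd d) →ₗ[ℂ] Ext (Cd d) :=
  CliffordAlgebra.contractLeft (Q := (0 : QuadraticForm ℂ (Cotangent (Cd d)))) (vecDzbar i)

/-- `∂̄^* = -2 ∑_i (∂/∂z^i) ι_{∂/∂z̄^i}`. -/
def dbarStar {d : ℕ} (α : Form (Cd d)) : Form (Cd d) :=
  fun z => (-2 : ℂ) • ∑ i : Fin d, formPartialZ i (fun w => contractZbar i (α w)) z

/-- The heat kernel `H(t, z, z̄) = (2πt)^{-d} exp(-∑_i z^i z̄^i / (2t)) d^d z̄`. -/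
def heatKernel (d : ℕ) (t : ℝ) : Form (Cd d) :=
  fun z => (1 / (2 * (Real.pi : ℂ) * t) ^ d *
    Complex.exp (-(∑ i, z i * conj (z i)) / (2 * t))) • ddzbar d

/-- The regularized propagator `∫_ε^L ∂̄^* H(t, z, z̄) dt`, as a form in the difference variable
`z ∈ ℂ^d`. -/
def propagator (d : ℕ) (ε L : ℝ) : Form (Cd d) :=
  fun z => coeffwise (fun f : ℝ → ℂ => ∫ t in ε..L, f t) fun t => dbarStar (heatKernel d t) z

/-! ### Decorated graphs and regularized Feynman graph integrals -/

/-- A finite decorated directed graph with ordered vertices and ordered edges: the vertices are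
`0, …, numV - 1`, the edges are `0, …, numE - 1`. -/
structure DecoratedGraph (d : ℕ) where
  /-- the number of vertices -/
  numV : ℕ
  /-- the number of edges -/
  numE : ℕ
  /-- the tail of an edge -/
  tail : Fin numE → Fin numV
  /-- the head of an edge -/
  head : Fin numE → Fin numV
  /-- the decoration: `d` non-negative integers for each edge -/
  deco : Fin numE → Fin d → ℕ

/-- The space `(ℂ^d)^N` of positions of `N` points. -/
abbrev Positions (d N : ℕ) : Type := Fin N → Cd d

/-- The linear map `(z_v)_v ↦ z_a - z_b`. -/
def diffMap (d : ℕ) {N : ℕ} (a b : Fin N) : Positions d N →ₗ[ℝ] Cd d :=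
  (LinearMap.proj a : Positions d N →ₗ[ℝ] Cd d) - LinearMap.proj b

/-- The standard oriented real frame of `(ℂ^d)^N`: with real coordinates `z_v^i = x_v^i + √-1 y_v^i`
it lists `∂/∂x_v^i, ∂/∂y_v^i` pair by pair, the pairs `(v, i)` in lexicographic order. -/
def frame (d N : ℕ) (k : Fin (N * d * 2)) : Positions d N :=
  let q := finProdFinEquiv.symm k
  let p := finProdFinEquiv.symm q.1
  Pi.single p.1 (Pi.single p.2 (if q.2 = 0 then 1 else Complex.I))

/-- Evaluation of a covector on the standard frame. -/
def evalFrame (d N : ℕ) : Cotangent (Positions d N) →ₗ[ℂ] (Fin (N * d * 2) → ℂ) where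
  toFun l k := l (frame d N k)
  map_add' _ _ := rfl
  map_smul' _ _ := rfl

/-- The coefficient of the volume form `∏_{v, i} dx_v^i ∧ dy_v^i` in an element of the exterior
algebra: components of lower degree are killed, and `l_1 ∧ ⋯ ∧ l_m` of top degree `m` goes to the
determinant of the matrix of values of the `l_j` on the standard frame. -/
def topCoeff (d N : ℕ) : Ext (Positions d N) →ₗ[ℂ] ℂ :=
  ExteriorAlgebra.liftAlternating (R := ℂ) (M := Cotangent (Positions d N)) (N := ℂ)
    (Pi.single (N * d * 2)
      ((Matrix.detRowAlternating (n := Fin (N * d * 2)) (R := ℂ)).compLinearMap (evalFrame d N)))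

/-- Integration of forms over `(ℂ^d)^N` with its complex orientation. -/
def integrate {d N : ℕ} (α : Form (Positions d N)) : ℂ :=
  ∫ p, topCoeff d N (α p)

/-- The form `∂_{z_{h(e)}}^{n(e)} P̃_{ε,L}(z_{h(e)} - z_{t(e)}, z̄_{h(e)} - z̄_{t(e)})` of the
edge `e` on the space of positions of the vertices. -/
def edgeForm {d : ℕ} (Γ : DecoratedGraph d) (ε L : ℝ) (e : Fin Γ.numE) :
    Form (Positions d Γ.numV) :=
  pullback (diffMap d (Γ.head e) (Γ.tail e)) (formMultiPartialZ (Γ.deco e) (propagator d ε L))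

/-- The regularized Feynman graph integral `W_ε^L((Γ, n), Φ)`. -/
def W {d : ℕ} (Γ : DecoratedGraph d) (ε L : ℝ) (Φ : Form (Positions d Γ.numV)) : ℂ :=
  (-1) ^ ((d - 1) * (Γ.numE * (Γ.numE - 1) / 2) + Γ.numE) *
    integrate fun p => (List.ofFn fun e => edgeForm Γ ε L e p).prod * Φ p

/-- `W_0^L((Γ, n), Φ) = lim_{ε → 0} W_ε^L((Γ, n), Φ)` exists in `ℂ`. -/
def W0LExists {d : ℕ} (Γ : DecoratedGraph d) (L : ℝ) (Φ : Form (Positions d Γ.numV)) : Prop :=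
  ∃ w : ℂ, Tendsto (fun ε : ℝ => W Γ ε L Φ) (𝓝[>] 0) (𝓝 w)

/-- `W_0^{+∞}((Γ, n), Φ)`, the double limit of `W_ε^L((Γ, n), Φ)` as `(ε, L) → (0, +∞)` jointly,
exists in `ℂ`. -/
def W0InftyExists {d : ℕ} (Γ : DecoratedGraph d) (Φ : Form (Positions d Γ.numV)) : Prop :=
  ∃ w : ℂ, Tendsto (fun q : ℝ × ℝ => W Γ q.1 q.2 Φ) ((𝓝[>] 0) ×ˢ atTop) (𝓝 w)

end FeynmanGraph

end

open Filter Topology MeasureTheory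
open scoped ContDiff ComplexConjugate BoundedContinuousFunction

noncomputable section

namespace FeynmanGraph

/-! ### Uniform boundedness on test functions and smooth families of them -/

section UniformBoundedness

variable {E : Type*} [NormedAddCommGroup E] [NormedSpace ℝ E]

/-! The substitution u = 1/t splits the propagator between times ε and L as T(1/ε) - T(1/L), where
T(s) has the coefficients z̄^i (2π)^{-d} ∫_0^s u^{d-1} e^{-u|z|²/2} du (`tailCoeff`). These are
jointly smooth in (s, z), also across s = 0, which corresponds to infinite time. Hence, for another
upper cutoff L' and s = 1/L', the edge factor for L' is the one for L plus the derivative of T(1/L)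
- T(s), a form that stays smooth up to s = 0. Expanding the product over the edges turns the
integral with cutoff L' into a finite sum, up to signs, of integrals with the fixed cutoff L, over
graphs with some edges deleted, against compactly supported forms depending smoothly on s
(`exists_tendsto_integral_edgeProd_mul_edgeProd`).

The hypothesis gives the limit ε → 0 for each fixed form, whereas here the form moves with s. The
joint limit is a uniform boundedness statement: functionals converging pointwise on test functions
are equicontinuous. The Fréchet topology on test functions is avoided by applying Banach-Steinhaus
on ℓ^∞, through superpositions ∑ a_n g_n of a rapidly decreasing sequence of test functions
(`exists_norm_integral_mul_le_of_summable`, `exists_tendsto_integral_mul_family`). -/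

theorem iteratedFDeriv_const_mul_apply {f : E → ℂ} (hf : ContDiff ℝ ∞ f) (c : ℂ) (k : ℕ) (p : E) :
    iteratedFDeriv ℝ k (fun p => c * f p) p = c • iteratedFDeriv ℝ k f p :=
  iteratedFDeriv_const_smul_apply (a := c) (f := f)
    (hf.contDiffAt.of_le (by exact_mod_cast le_top))

/-- The derivatives in `p` of a jointly smooth function `f (s, p)`, supported in a compact set of
values of `p`, depend on `s` in a Lipschitz way near `s = 0`, uniformly in `p`. -/
theorem exists_norm_iteratedFDeriv_slice_sub_le {f : ℝ × E → ℂ} (hf : ContDiff ℝ ∞ f) {K : Set E}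
    (hK : IsCompact K) (hsupp : ∀ s p, p ∉ K → f (s, p) = 0) (k : ℕ) :
    ∃ C : ℝ, 0 ≤ C ∧ ∀ s ∈ Set.Icc (-1 : ℝ) 1, ∀ p : E,
      ‖iteratedFDeriv ℝ k (fun p => f (s, p) - f (0, p)) p‖ ≤ C * |s| := by
  have hslice : ∀ s : ℝ, ContDiff ℝ ∞ fun p => f (s, p) := fun s =>
    hf.comp (contDiff_const.prodMk contDiff_id)
  have hF : ContDiff ℝ 1 (iteratedFDeriv ℝ k f) :=
    hf.iteratedFDeriv_right (by exact_mod_cast le_top)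
  have hcont : Continuous fun q : ℝ × E => fderiv ℝ (iteratedFDeriv ℝ k f) q (1, 0) :=
    (hF.continuous_fderiv one_ne_zero).clm_apply continuous_const
  obtain ⟨M, hM⟩ := ((isCompact_Icc (a := (-1 : ℝ)) (b := 1)).prod hK).exists_bound_of_continuousOn
    hcont.continuousOn
  -- A slice derivative is the full k-th derivative restricted to the p-directions, so its variation
  -- in s is controlled by the mean value inequality for one smooth map.
  have hformula : ∀ (s : ℝ) (p : E), iteratedFDeriv ℝ k (fun p => f (s, p)) p =
      (iteratedFDeriv ℝ k f (s, p)).compContinuousLinearMap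
        fun _ => ContinuousLinearMap.inr ℝ ℝ E := by
    intro s p
    have h1 : (fun p => f (s, p)) = (fun q => f ((s, 0) + q)) ∘ ContinuousLinearMap.inr ℝ ℝ E := by
      ext p; simp
    have h2 : ContDiff ℝ ∞ fun q => f ((s, 0) + q) := hf.comp (contDiff_const.add contDiff_id)
    rw [h1, ContinuousLinearMap.iteratedFDeriv_comp_right _ h2 p (by exact_mod_cast le_top),
      iteratedFDeriv_comp_add_left]
    simp
  -- The absolute value covers empty K, where the bound M carries no information about its sign.
  refine ⟨|M|, abs_nonneg _, fun s hs p => ?_⟩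
  have hsub : iteratedFDeriv ℝ k (fun p => f (s, p) - f (0, p)) p =
      iteratedFDeriv ℝ k (fun p => f (s, p)) p - iteratedFDeriv ℝ k (fun p => f (0, p)) p :=
    iteratedFDeriv_sub_apply ((hslice s).contDiffAt.of_le (by exact_mod_cast le_top))
      ((hslice 0).contDiffAt.of_le (by exact_mod_cast le_top))
  by_cases hp : p ∈ K
  · rw [hsub, hformula, hformula]
    have hlip : ‖iteratedFDeriv ℝ k f (s, p) - iteratedFDeriv ℝ k f (0, p)‖ ≤ |M| * ‖s - 0‖ := by
      refine Convex.norm_image_sub_le_of_norm_hasDerivWithin_le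
        (f := fun s => iteratedFDeriv ℝ k f (s, p))
        (f' := fun s => fderiv ℝ (iteratedFDeriv ℝ k f) (s, p) (1, 0)) (s := Set.Icc (-1) 1)
        (fun x _ => ?_) (fun x hx => (hM (x, p) ⟨hx, hp⟩).trans (le_abs_self M))
        (convex_Icc _ _) (by simp) hs
      have h2 : HasDerivAt (fun x : ℝ => (x, p)) ((1 : ℝ), (0 : E)) x :=
        (hasDerivAt_id x).prodMk (hasDerivAt_const x p)
      exact ((hF.differentiable one_ne_zero (x, p)).hasFDerivAt.comp_hasDerivAt x
        h2).hasDerivWithinAt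
    have hinr : ‖ContinuousLinearMap.inr ℝ ℝ E‖ ≤ 1 :=
      ContinuousLinearMap.opNorm_le_bound _ zero_le_one fun x => by simp
    calc ‖(iteratedFDeriv ℝ k f (s, p)).compContinuousLinearMap
            (fun _ => ContinuousLinearMap.inr ℝ ℝ E) -
          (iteratedFDeriv ℝ k f (0, p)).compContinuousLinearMap
            (fun _ => ContinuousLinearMap.inr ℝ ℝ E)‖
        = ‖(iteratedFDeriv ℝ k f (s, p) - iteratedFDeriv ℝ k f (0, p)).compContinuousLinearMap
            (fun _ => ContinuousLinearMap.inr ℝ ℝ E)‖ := rfl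
      _ ≤ ‖iteratedFDeriv ℝ k f (s, p) - iteratedFDeriv ℝ k f (0, p)‖ *
            ∏ _i : Fin k, ‖ContinuousLinearMap.inr ℝ ℝ E‖ :=
          ContinuousMultilinearMap.norm_compContinuousLinearMap_le _ _
      _ ≤ ‖iteratedFDeriv ℝ k f (s, p) - iteratedFDeriv ℝ k f (0, p)‖ * 1 := by
          gcongr
          exact Finset.prod_le_one (fun _ _ => norm_nonneg _) fun _ _ => hinr
      _ ≤ |M| * |s| := by simpa using hlip
  · have hts : tsupport (fun p => f (s, p) - f (0, p)) ⊆ K :=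
      closure_minimal (fun x hx => by
        by_contra hxK
        exact hx (by simp [hsupp _ x hxK])) hK.isClosed
    have hzero : iteratedFDeriv ℝ k (fun p => f (s, p) - f (0, p)) p = 0 := by
      by_contra hne
      exact hp (hts (support_iteratedFDeriv_subset k hne))
    rw [hzero, norm_zero]
    positivity

variable [MeasurableSpace E] [BorelSpace E] {μ : Measure E}
  [IsFiniteMeasureOnCompacts μ]

/-- If `∫ uₘ φ` converges for every test function `φ`, then the functionals `φ ↦ ∫ uₘ φ` are
uniformly bounded on a sequence of test functions `g n` whose derivatives of every order are
summable in sup norm. -/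
theorem exists_norm_integral_mul_le_of_summable {u : ℕ → E → ℂ} (hu : ∀ m, Continuous (u m))
    (hconv : ∀ φ : E → ℂ, ContDiff ℝ ∞ φ → HasCompactSupport φ →
      ∃ w, Tendsto (fun m => ∫ p, u m p * φ p ∂μ) atTop (𝓝 w))
    {g : ℕ → E → ℂ} (hg : ∀ n, ContDiff ℝ ∞ (g n)) {K : Set E} (hK : IsCompact K)
    (hsupp : ∀ n, ∀ p ∉ K, g n p = 0) {v : ℕ → ℕ → ℝ} (hv : ∀ k, Summable (v k))
    (hgv : ∀ k n p, ‖iteratedFDeriv ℝ k (g n) p‖ ≤ v k n) :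
    ∃ C : ℝ, ∀ m n, ‖∫ p, u m p * g n p ∂μ‖ ≤ C := by
  classical
  have hgv0 : ∀ n p, ‖g n p‖ ≤ v 0 n := fun n p => by simpa using hgv 0 n p
  have hle : ∀ (a : ℕ →ᵇ ℂ) n p, ‖a n * g n p‖ ≤ ‖a‖ * v 0 n := fun a n p => by
    rw [norm_mul]
    exact mul_le_mul (a.norm_coe_le_norm n) (hgv0 n p) (norm_nonneg _) (norm_nonneg _)
  have hsum : ∀ (a : ℕ →ᵇ ℂ) p, Summable fun n => a n * g n p := fun a p =>
    Summable.of_norm_bounded ((hv 0).mul_left ‖a‖) fun n => hle a n p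
  let S : (ℕ →ᵇ ℂ) → E → ℂ := fun a p => ∑' n, a n * g n p
  have hSsmooth : ∀ a, ContDiff ℝ ∞ (S a) := fun a => by
    refine contDiff_tsum (N := ⊤) (v := fun k n => ‖a‖ * v k n)
      (fun n => contDiff_const.mul (hg n)) (fun k _ => (hv k).mul_left _) fun k n p _ => ?_
    rw [iteratedFDeriv_const_mul_apply (hg n), norm_smul]
    exact mul_le_mul (a.norm_coe_le_norm n) (hgv k n p) (norm_nonneg _) (norm_nonneg _)
  have hSzero : ∀ a, ∀ p ∉ K, S a p = 0 := fun a p hp => by simp [S, hsupp _ p hp]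
  have hSsupp : ∀ a, HasCompactSupport (S a) := fun a => HasCompactSupport.intro hK (hSzero a)
  have hint : ∀ m a, Integrable (fun p => u m p * S a p) μ := fun m a =>
    ((hu m).mul (hSsmooth a).continuous).integrable_of_hasCompactSupport (hSsupp a).mul_left
  have hSnorm : ∀ a p, ‖S a p‖ ≤ ‖a‖ * ∑' n, v 0 n := fun a p => by
    rw [← tsum_mul_left]
    exact tsum_of_norm_bounded ((hv 0).mul_left ‖a‖).hasSum fun n => hle a n p
  let Λ : ℕ → (ℕ →ᵇ ℂ) →L[ℂ] ℂ := fun m => LinearMap.mkContinuous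
    { toFun := fun a => ∫ p, u m p * S a p ∂μ
      map_add' := fun a b => by
        rw [← integral_add (hint m a) (hint m b)]
        refine integral_congr_ae (.of_forall fun p => ?_)
        simp only [S, BoundedContinuousFunction.coe_add, Pi.add_apply, add_mul]
        rw [(hsum a p).tsum_add (hsum b p), mul_add]
      map_smul' := fun c a => by
        rw [RingHom.id_apply, smul_eq_mul, ← integral_const_mul]
        refine integral_congr_ae (.of_forall fun p => ?_)
        simp only [S, BoundedContinuousFunction.coe_smul, smul_eq_mul, mul_assoc]
        rw [tsum_mul_left]
        ring }
    ((∫ p in K, ‖u m p‖ ∂μ) * ∑' n, v 0 n) fun a => by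
      have hKi : IntegrableOn (fun p => ‖u m p‖) K μ :=
        (hu m).norm.continuousOn.integrableOn_compact hK
      have h1 : ∫ p, u m p * S a p ∂μ = ∫ p in K, u m p * S a p ∂μ :=
        (setIntegral_eq_integral_of_forall_compl_eq_zero fun p hp => by simp [hSzero a p hp]).symm
      calc ‖∫ p, u m p * S a p ∂μ‖ = ‖∫ p in K, u m p * S a p ∂μ‖ := by rw [h1]
        _ ≤ ∫ p in K, ‖u m p‖ * (‖a‖ * ∑' n, v 0 n) ∂μ := by
            refine norm_integral_le_of_norm_le (hKi.mul_const _) (.of_forall fun p => ?_)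
            rw [norm_mul]
            exact mul_le_mul_of_nonneg_left (hSnorm a p) (norm_nonneg _)
        _ = (∫ p in K, ‖u m p‖ ∂μ) * (∑' n, v 0 n) * ‖a‖ := by
            rw [integral_mul_const]; ring
  -- Every S a is itself a test function, so convergence bounds Λ m a in m for each a; completeness
  -- of ℓ^∞ makes the bound uniform, and the unit sequences recover the g n.
  obtain ⟨C, hC⟩ := banach_steinhaus (g := Λ) fun a => by
    obtain ⟨w, hw⟩ := hconv (S a) (hSsmooth a) (hSsupp a)
    obtain ⟨C, hC⟩ := (Metric.isBounded_range_of_tendsto _ hw).exists_norm_le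
    exact ⟨C, fun m => hC _ ⟨m, rfl⟩⟩
  refine ⟨C, fun m n => ?_⟩
  let δ : ℕ →ᵇ ℂ := BoundedContinuousFunction.ofNormedAddCommGroupDiscrete
    (Pi.single n (1 : ℂ)) 1 fun k => by
      by_cases hk : k = n
      · subst hk; simp
      · simp [hk]
  have hδ : ‖δ‖ ≤ 1 := BoundedContinuousFunction.norm_ofNormedAddCommGroup_le _ zero_le_one _
  have hS : S δ = g n := by
    ext p
    have : S δ p = δ n * g n p := tsum_eq_single n fun k hk => by simp [δ, hk]
    simpa [δ] using this
  calc ‖∫ p, u m p * g n p ∂μ‖ = ‖Λ m δ‖ := by rw [← hS]; rfl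
    _ ≤ ‖Λ m‖ * ‖δ‖ := (Λ m).le_opNorm δ
    _ ≤ C * 1 := mul_le_mul (hC m) hδ (norm_nonneg _) ((norm_nonneg _).trans (hC m))
    _ = C := mul_one C

/-- If the functionals `φ ↦ ∫ u_ε φ` converge pointwise on test functions as `ε → 0⁺`, then they
converge jointly along smooth families of test functions. -/
theorem exists_tendsto_integral_mul_family {u : ℝ → E → ℂ} (hu : ∀ ε, 0 < ε → Continuous (u ε))
    (hconv : ∀ φ : E → ℂ, ContDiff ℝ ∞ φ → HasCompactSupport φ →
      ∃ w, Tendsto (fun ε => ∫ p, u ε p * φ p ∂μ) (𝓝[>] 0) (𝓝 w))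
    {f : ℝ × E → ℂ} (hf : ContDiff ℝ ∞ f) {K : Set E} (hK : IsCompact K)
    (hsupp : ∀ s p, p ∉ K → f (s, p) = 0) :
    ∃ w, Tendsto (fun q : ℝ × ℝ => ∫ p, u q.1 p * f (q.2, p) ∂μ) (𝓝[>] 0 ×ˢ 𝓝 0) (𝓝 w) := by
  have hslice : ∀ s : ℝ, ContDiff ℝ ∞ fun p => f (s, p) := fun s =>
    hf.comp (contDiff_const.prodMk contDiff_id)
  have hcs : ∀ s : ℝ, HasCompactSupport fun p => f (s, p) := fun s =>
    HasCompactSupport.intro hK fun p => hsupp s p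
  obtain ⟨w, hw⟩ := hconv _ (hslice 0) (hcs 0)
  -- It suffices to find a good subsequence of each sequence; it is chosen so that the family
  -- parameter is below 4^{-n}.
  refine ⟨w, tendsto_of_subseq_tendsto fun x hx => ?_⟩
  have hx1 : Tendsto (fun n => (x n).1) atTop (𝓝[>] 0) := tendsto_fst.comp hx
  have hx2 : Tendsto (fun n => (x n).2) atTop (𝓝 0) := tendsto_snd.comp hx
  obtain ⟨ms, hmono, hms⟩ := Filter.extraction_forall_of_eventually'
    (P := fun n k => 0 < (x k).1 ∧ |(x k).2| < (1 / 4 : ℝ) ^ n) fun n => by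
      refine eventually_atTop.1 ?_
      have h1 : ∀ᶠ k in atTop, 0 < (x k).1 := hx1 self_mem_nhdsWithin
      have h2 := (Metric.tendsto_nhds.1 hx2) ((1 / 4 : ℝ) ^ n) (by positivity)
      filter_upwards [h1, h2] with k hk1 hk2
      exact ⟨hk1, by simpa using hk2⟩
  refine ⟨ms, ?_⟩
  set ε : ℕ → ℝ := fun n => (x (ms n)).1 with hε
  set s : ℕ → ℝ := fun n => (x (ms n)).2 with hs
  have hεpos : ∀ n, 0 < ε n := fun n => (hms n).1
  have hsle : ∀ n, |s n| ≤ (1 / 4 : ℝ) ^ n := fun n => (hms n).2.le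
  have hεlim : Tendsto ε atTop (𝓝[>] 0) := hx1.comp hmono.tendsto_atTop
  -- The decay 4^{-n} is shared: after multiplication by 2^n the derivatives are still summable like
  -- 2^{-n}, and the other factor 2^{-n} sends the bounded integrals against g n to zero.
  let g : ℕ → E → ℂ := fun n p => (2 : ℂ) ^ n * (f (s n, p) - f (0, p))
  choose C hC0 hC using exists_norm_iteratedFDeriv_slice_sub_le hf hK hsupp
  obtain ⟨B, hB⟩ := exists_norm_integral_mul_le_of_summable (μ := μ) (u := fun m => u (ε m))
    (fun m => hu _ (hεpos m)) (fun φ h1 h2 => (hconv φ h1 h2).imp fun w hw => hw.comp hεlim)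
    (g := g) (fun n => contDiff_const.mul ((hslice _).sub (hslice 0))) hK
    (fun n p hp => by simp [g, hsupp _ p hp]) (v := fun k n => C k * (1 / 2 : ℝ) ^ n)
    (fun k => (summable_geometric_of_lt_one (by norm_num) (by norm_num)).mul_left _)
    (fun k n p => by
      have h1 : iteratedFDeriv ℝ k (g n) p =
          (2 : ℂ) ^ n • iteratedFDeriv ℝ k (fun p => f (s n, p) - f (0, p)) p :=
        iteratedFDeriv_const_mul_apply ((hslice _).sub (hslice 0)) _ k p
      have h2 : s n ∈ Set.Icc (-1 : ℝ) 1 :=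
        abs_le.1 ((hsle n).trans (pow_le_one₀ (by norm_num) (by norm_num)))
      rw [h1, norm_smul, norm_pow, Complex.norm_ofNat]
      calc (2 : ℝ) ^ n * ‖iteratedFDeriv ℝ k (fun p => f (s n, p) - f (0, p)) p‖
          ≤ 2 ^ n * (C k * (1 / 4) ^ n) := by
            gcongr
            exact (hC k _ h2 p).trans (mul_le_mul_of_nonneg_left (hsle n) (hC0 k))
        _ = C k * (1 / 2) ^ n := by
            rw [mul_left_comm, ← mul_pow]; norm_num)
  have hsplit : ∀ n, ∫ p, u (ε n) p * f (s n, p) ∂μ =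
      (∫ p, u (ε n) p * f (0, p) ∂μ) + (1 / 2 : ℂ) ^ n * ∫ p, u (ε n) p * g n p ∂μ := fun n => by
    have hcont := hu _ (hεpos n)
    have hi : ∀ s, Integrable (fun p => u (ε n) p * f (s, p)) μ := fun s =>
      (hcont.mul (hslice s).continuous).integrable_of_hasCompactSupport (hcs s).mul_left
    rw [← integral_const_mul, ← sub_eq_iff_eq_add', ← integral_sub (hi _) (hi _)]
    refine integral_congr_ae (.of_forall fun p => ?_)
    have : (1 / 2 : ℂ) ^ n * 2 ^ n = 1 := by rw [← mul_pow]; norm_num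
    simp only [g]
    linear_combination -(u (ε n) p * (f (s n, p) - f (0, p))) * this
  have hlim0 : Tendsto (fun n => (1 / 2 : ℂ) ^ n * ∫ p, u (ε n) p * g n p ∂μ) atTop (𝓝 0) := by
    refine squeeze_zero_norm (a := fun n => (1 / 2 : ℝ) ^ n * B) (fun n => ?_) ?_
    · rw [norm_mul, norm_pow]
      have : ‖(1 / 2 : ℂ)‖ = 1 / 2 := by norm_num
      rw [this]
      exact mul_le_mul_of_nonneg_left (hB n n) (by positivity)
    · simpa using (tendsto_pow_atTop_nhds_zero_of_lt_one (r := (1 / 2 : ℝ)) (by norm_num)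
        (by norm_num)).mul_const B
  have := (hw.comp hεlim).add hlim0
  rw [add_zero] at this
  exact this.congr fun n => (hsplit n).symm

end UniformBoundedness

/-! ### The time integral of the heat kernel -/

/-- The moments `∫_0^1 v^k e^{-x v / 2} dv`. -/
def expMoment (k : ℕ) (x : ℝ) : ℝ := ∫ v in (0 : ℝ)..1, v ^ k * Real.exp (-(x * v) / 2)

/-- Differentiation under the integral sign gives back a moment of the next order; iterating this
yields smoothness on the whole real line. -/
theorem hasDerivAt_expMoment (k : ℕ) (x : ℝ) :
    HasDerivAt (expMoment k) (-(1 / 2) * expMoment (k + 1) x) x := by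
  have h := intervalIntegral.hasDerivAt_integral_of_dominated_loc_of_deriv_le (μ := volume)
    (a := 0) (b := 1) (x₀ := x) (s := Metric.ball x 1)
    (F := fun x v : ℝ => v ^ k * Real.exp (-(x * v) / 2))
    (F' := fun x v : ℝ => -(1 / 2) * (v ^ (k + 1) * Real.exp (-(x * v) / 2)))
    (bound := fun _ => Real.exp ((|x| + 1) / 2)) (Metric.ball_mem_nhds x one_pos)
    (.of_forall fun y => (by fun_prop : Continuous fun v : ℝ =>
      v ^ k * Real.exp (-(y * v) / 2)).aestronglyMeasurable)
    ((by fun_prop : Continuous fun v : ℝ =>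
      v ^ k * Real.exp (-(x * v) / 2)).intervalIntegrable _ _)
    (by fun_prop : Continuous fun v : ℝ =>
      -(1 / 2) * (v ^ (k + 1) * Real.exp (-(x * v) / 2))).aestronglyMeasurable
    (.of_forall fun v hv y hy => ?_) intervalIntegrable_const
    (.of_forall fun v _ y _ => ?_)
  · have := h.2
    rw [intervalIntegral.integral_const_mul] at this
    exact this
  · rw [Set.uIoc_of_le zero_le_one] at hv
    have hy' : |y| ≤ |x| + 1 := by
      have h1 : |y - x| < 1 := by simpa [Real.dist_eq] using hy
      have h2 := abs_sub_abs_le_abs_sub y x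
      linarith
    have h3 : v ^ (k + 1) ≤ 1 := pow_le_one₀ hv.1.le hv.2
    have h4 : -(y * v) ≤ |x| + 1 := by
      calc -(y * v) ≤ |y * v| := neg_le_abs _
        _ = |y| * v := by rw [abs_mul, abs_of_pos hv.1]
        _ ≤ |y| * 1 := mul_le_mul_of_nonneg_left hv.2 (abs_nonneg y)
        _ ≤ |x| + 1 := by rwa [mul_one]
    have h5 : 0 ≤ v ^ (k + 1) := pow_nonneg hv.1.le _
    rw [norm_mul, norm_mul, Real.norm_of_nonneg h5, Real.norm_of_nonneg (Real.exp_pos _).le]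
    calc ‖(-(1 / 2) : ℝ)‖ * (v ^ (k + 1) * Real.exp (-(y * v) / 2))
        ≤ 1 * (1 * Real.exp ((|x| + 1) / 2)) := by
          gcongr
          norm_num [abs_of_pos]
      _ = Real.exp ((|x| + 1) / 2) := by ring
  · have h1 : HasDerivAt (fun y : ℝ => -(y * v) / 2) (-(1 * v) / 2) y :=
      (((hasDerivAt_id y).mul_const v).neg).div_const 2
    refine (h1.exp.const_mul (v ^ k)).congr_deriv ?_
    ring

theorem contDiff_expMoment (k : ℕ) : ContDiff ℝ ∞ (expMoment k) := by
  refine contDiff_infty.2 fun n => ?_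
  induction n generalizing k with
  | zero => exact contDiff_zero.2 (continuous_iff_continuousAt.2 fun x =>
      (hasDerivAt_expMoment k x).continuousAt)
  | succ n ih =>
    rw [Nat.cast_succ]
    refine contDiff_succ_iff_deriv.2 ⟨fun x => (hasDerivAt_expMoment k x).differentiableAt,
      ?_, ?_⟩
    · simp
    · rw [funext fun x => (hasDerivAt_expMoment k x).deriv]
      exact contDiff_const.mul (ih _)

/-- Rescaling u = a v identifies the function with ∫_0^a u^k e^{-ur/2} du. The moment form makes
joint smoothness in a and r visible, at a = 0 and for negative a as well. -/
theorem hasDerivAt_pow_mul_expMoment (k : ℕ) (r a : ℝ) :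
    HasDerivAt (fun a => a ^ (k + 1) * expMoment k (a * r)) (a ^ k * Real.exp (-(a * r) / 2)) a := by
  have hcont : Continuous fun u : ℝ => u ^ k * Real.exp (-(u * r) / 2) := by fun_prop
  have h : (fun a => a ^ (k + 1) * expMoment k (a * r)) =
      fun a => ∫ u in (0 : ℝ)..a, u ^ k * Real.exp (-(u * r) / 2) := by
    ext a
    have := intervalIntegral.smul_integral_comp_mul_left (a := 0) (b := 1)
      (fun u : ℝ => u ^ k * Real.exp (-(u * r) / 2)) a
    rw [mul_zero, mul_one] at this
    rw [← this, expMoment, pow_succ', mul_assoc, ← intervalIntegral.integral_const_mul, smul_eq_mul]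
    congr 1
    refine intervalIntegral.integral_congr fun v _ => ?_
    simp only [mul_pow]
    ring_nf
  rw [h]
  exact hcont.integral_hasStrictDerivAt 0 a |>.hasDerivAt

/-- The squared Euclidean norm `∑ z^i z̄^i`. -/
def sqNorm {d : ℕ} (z : Cd d) : ℝ := ∑ i, ((z i).re ^ 2 + (z i).im ^ 2)

theorem coe_sqNorm {d : ℕ} (z : Cd d) : (sqNorm z : ℂ) = ∑ i, z i * conj (z i) := by
  simp [sqNorm, Complex.mul_conj, Complex.normSq_apply, pow_two]

/-- The coefficients of the propagator between the times `1 / a` and `+∞`. -/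
def tailCoeff {d : ℕ} (i : Fin d) (a : ℝ) (z : Cd d) : ℂ :=
  conj (z i) * ((((2 * Real.pi) ^ d)⁻¹ * (a ^ d * expMoment (d - 1) (a * sqNorm z)) : ℝ) : ℂ)

theorem contDiff_tailCoeff {d : ℕ} (i : Fin d) :
    ContDiff ℝ ∞ fun q : ℝ × Cd d => tailCoeff i q.1 q.2 := by
  have hz : ∀ j, ContDiff ℝ ∞ fun q : ℝ × Cd d => q.2 j := fun j =>
    (contDiff_apply ℝ ℂ j).comp contDiff_snd
  have hsq : ContDiff ℝ ∞ fun q : ℝ × Cd d => sqNorm q.2 :=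
    ContDiff.sum fun j _ => ((Complex.reCLM.contDiff.comp (hz j)).pow 2).add
      ((Complex.imCLM.contDiff.comp (hz j)).pow 2)
  refine (Complex.conjCLE.contDiff.comp (hz i)).mul (Complex.ofRealCLM.contDiff.comp ?_)
  exact contDiff_const.mul ((contDiff_fst.pow d).mul
    ((contDiff_expMoment _).comp (contDiff_fst.mul hsq)))

/-- This is the substitution u = 1/t: it provides a primitive in t of the coefficients of ∂̄^* of
the heat kernel. -/
theorem hasDerivAt_tailCoeff_inv {d : ℕ} (i : Fin d) (z : Cd d) {t : ℝ} (ht : 0 < t) :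
    HasDerivAt (fun t : ℝ => -tailCoeff i t⁻¹ z)
      (-2 * (1 / (2 * (Real.pi : ℂ) * t) ^ d *
        Complex.exp (-(∑ j, z j * conj (z j)) / (2 * t)) * (-conj (z i) / (2 * t)))) t := by
  -- The index i forces d ≥ 1, so the subtraction d - 1 in `tailCoeff` is not truncated.
  obtain ⟨k, rfl⟩ : ∃ k, d = k + 1 := ⟨d - 1, by have := i.pos; omega⟩
  have h1 := (hasDerivAt_pow_mul_expMoment k (sqNorm z) t⁻¹).comp t (hasDerivAt_inv ht.ne')
  have h2 := (((h1.const_mul ((2 * Real.pi) ^ (k + 1))⁻¹).ofReal_comp).const_mul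
    (conj (z i))).neg
  refine h2.congr_deriv ?_
  rw [← coe_sqNorm]
  have hexp : (-(sqNorm z : ℂ)) / (2 * t) = ((-(t⁻¹ * sqNorm z) / 2 : ℝ) : ℂ) := by
    have : (t : ℂ) ≠ 0 := by exact_mod_cast ht.ne'
    push_cast
    field_simp
  rw [hexp, ← Complex.ofReal_exp]
  have ht' : (t : ℂ) ≠ 0 := by exact_mod_cast ht.ne'
  have hpi : (Real.pi : ℂ) ≠ 0 := by exact_mod_cast Real.pi_ne_zero
  push_cast
  rw [mul_pow (2 * (Real.pi : ℂ)) t, inv_pow]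
  field_simp
  ring

theorem intervalIntegrable_heatKernel_coeff {d : ℕ} (i : Fin d) (z : Cd d) {ε L : ℝ} (hε : 0 < ε)
    (hL : 0 < L) :
    IntervalIntegrable (fun t : ℝ => (-2 * (1 / (2 * (Real.pi : ℂ) * t) ^ d *
      Complex.exp (-(∑ j, z j * conj (z j)) / (2 * t)) * (-conj (z i) / (2 * t))))) volume ε L := by
  refine ContinuousOn.intervalIntegrable fun t ht => ContinuousAt.continuousWithinAt ?_
  have ht' : (t : ℂ) ≠ 0 := by exact_mod_cast ((lt_min hε hL).trans_le ht.1).ne'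
  have hpi : (Real.pi : ℂ) ≠ 0 := by exact_mod_cast Real.pi_ne_zero
  have h2 : (2 * (Real.pi : ℂ) * t) ^ d ≠ 0 :=
    pow_ne_zero _ (mul_ne_zero (mul_ne_zero two_ne_zero hpi) ht')
  have h3 : 2 * (t : ℂ) ≠ 0 := by simpa using ht'
  have hc : ContinuousAt (fun t : ℝ => (t : ℂ)) t := Complex.continuous_ofReal.continuousAt
  fun_prop (disch := assumption)

theorem integral_heatKernel_coeff {d : ℕ} (i : Fin d) (z : Cd d) {ε L : ℝ} (hε : 0 < ε)
    (hL : 0 < L) :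
    ∫ t in ε..L, (-2 * (1 / (2 * (Real.pi : ℂ) * t) ^ d *
        Complex.exp (-(∑ j, z j * conj (z j)) / (2 * t)) * (-conj (z i) / (2 * t)))) =
      tailCoeff i ε⁻¹ z - tailCoeff i L⁻¹ z := by
  rw [intervalIntegral.integral_eq_sub_of_hasDerivAt
    (fun t ht => hasDerivAt_tailCoeff_inv i z ((lt_min hε hL).trans_le ht.1))
    (intervalIntegrable_heatKernel_coeff i z hε hL)]
  ring

/-! ### Holomorphic derivatives -/

theorem partialZ_eq_fderiv {d : ℕ} (i : Fin d) {z : Cd d} {f : Cd d → ℂ}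
    (hf : DifferentiableAt ℝ f z) :
    partialZ i z f =
      (fderiv ℝ f z (Pi.single i 1) - Complex.I * fderiv ℝ f z (Pi.single i Complex.I)) / 2 := by
  rw [partialZ, hf.lineDeriv_eq_fderiv, hf.lineDeriv_eq_fderiv]

theorem partialZ_sum_mul {d : ℕ} {ι : Type*} [Fintype ι] (i : Fin d) {z : Cd d}
    {f : ι → Cd d → ℂ} (hf : ∀ j, DifferentiableAt ℝ (f j) z) (a : ι → ℂ) :
    partialZ i z (fun w => ∑ j, a j * f j w) = ∑ j, a j * partialZ i z (f j) := by
  have h : HasFDerivAt (fun w => ∑ j, a j * f j w) (∑ j, a j • fderiv ℝ (f j) z) z :=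
    HasFDerivAt.fun_sum fun j _ => (hf j).hasFDerivAt.const_mul (a j)
  rw [partialZ_eq_fderiv i h.differentiableAt, h.fderiv]
  simp only [_root_.sum_apply, _root_.smul_apply, smul_eq_mul,
    Finset.mul_sum]
  rw [← Finset.sum_sub_distrib, Finset.sum_div]
  refine Finset.sum_congr rfl fun j _ => ?_
  rw [partialZ_eq_fderiv i (hf j)]
  ring

/-- Since ∂/∂z^i treats z̄ as constant, it extracts only z̄^i from |z|². The cancellation is seen on
the real directional derivatives along 1 and √-1. -/
theorem partialZ_heat {d : ℕ} (i : Fin d) (z : Cd d) (c b : ℂ) :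
    partialZ i z (fun w => c * Complex.exp (-(∑ j, w j * conj (w j)) / b)) =
      c * Complex.exp (-(∑ j, z j * conj (z j)) / b) * (-conj (z i) / b) := by
  have key : ∀ v : Cd d, lineDeriv ℝ (fun w => c * Complex.exp (-(∑ j, w j * conj (w j)) / b)) z v =
      c * (Complex.exp (-(∑ j, z j * conj (z j)) / b) *
        (-(∑ j, (v j * conj (z j) + z j * conj (v j))) / b)) := by
    intro v
    have hz : ∀ j, HasDerivAt (fun s : ℝ => (z + s • v) j) (v j) 0 := fun j => by
      have h1 : HasDerivAt (fun s : ℝ => (s : ℂ)) 1 0 := (hasDerivAt_id (0 : ℝ)).ofReal_comp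
      simpa using (h1.mul_const (v j)).const_add (z j)
    have hconj : ∀ j, HasDerivAt (fun s : ℝ => conj ((z + s • v) j)) (conj (v j)) 0 := fun j =>
      Complex.conjCLE.toContinuousLinearMap.hasFDerivAt.comp_hasDerivAt (0 : ℝ) (hz j)
    have hsum : HasDerivAt (fun s : ℝ => ∑ j, (z + s • v) j * conj ((z + s • v) j))
        (∑ j, (v j * conj (z j) + z j * conj (v j))) 0 :=
      HasDerivAt.fun_sum fun j _ => by simpa using (hz j).fun_mul (hconj j)
    have := ((hsum.neg.div_const b).cexp).const_mul c
    simpa [lineDeriv] using this.deriv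
  rw [partialZ, key, key]
  have h1 : ∀ x : ℂ, ∑ j, ((Pi.single i x : Cd d) j * conj (z j) +
      z j * conj ((Pi.single i x : Cd d) j)) = x * conj (z i) + z i * conj x := by
    intro x
    rw [Finset.sum_eq_single i]
    · simp
    · intro j _ hj; simp [hj]
    · simp
  rw [h1, h1, map_one, Complex.conj_I]
  linear_combination -c * Complex.exp (-(∑ j, z j * conj (z j)) / b) / (2 * b) *
    (z i - conj (z i)) * Complex.I_mul_I

/-- The operator `∂/∂z^i` preserves smooth dependence on parameters. -/
theorem contDiff_partialZ {d : ℕ} {Y : Type*} [NormedAddCommGroup Y] [NormedSpace ℝ Y] (i : Fin d)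
    {f : Y × Cd d → ℂ} (hf : ContDiff ℝ ∞ f) :
    ContDiff ℝ ∞ fun q : Y × Cd d => partialZ i q.2 fun w => f (q.1, w) := by
  have hd : Differentiable ℝ f := hf.differentiable (by simp)
  have hformula : (fun q : Y × Cd d => partialZ i q.2 fun w => f (q.1, w)) = fun q =>
      (fderiv ℝ f q (0, Pi.single i 1) - Complex.I * fderiv ℝ f q (0, Pi.single i Complex.I)) / 2 := by
    ext ⟨y, z⟩
    have h2 : HasFDerivAt (fun w : Cd d => f (y, w))
        ((fderiv ℝ f (y, z)).comp (ContinuousLinearMap.inr ℝ Y (Cd d))) z :=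
      (hd (y, z)).hasFDerivAt.comp z (hasFDerivAt_prodMk_right y z)
    rw [partialZ_eq_fderiv i h2.differentiableAt, h2.fderiv]
    simp
  rw [hformula]
  have hfd : ContDiff ℝ ∞ (fderiv ℝ f) := hf.fderiv_right (by simp)
  exact ((hfd.clm_apply contDiff_const).sub
    (contDiff_const.mul (hfd.clm_apply contDiff_const))).div_const 2

/-- The operator `∂_{z^1}^{n_1} ⋯ ∂_{z^d}^{n_d}` on functions. -/
def multiPartialZ {d : ℕ} (n : Fin d → ℕ) (f : Cd d → ℂ) : Cd d → ℂ :=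
  (List.finRange d).foldr (fun i g => (fun g z => partialZ i z g)^[n i] g) f

theorem contDiff_multiPartialZ {d : ℕ} {Y : Type*} [NormedAddCommGroup Y] [NormedSpace ℝ Y]
    (n : Fin d → ℕ) {f : Y × Cd d → ℂ} (hf : ContDiff ℝ ∞ f) :
    ContDiff ℝ ∞ fun q : Y × Cd d => multiPartialZ n (fun w => f (q.1, w)) q.2 := by
  unfold multiPartialZ
  induction List.finRange d with
  | nil => exact hf
  | cons i l ih =>
    simp only [List.foldr_cons]
    generalize (fun (y : Y) => List.foldr (fun i g => (fun g z => partialZ i z g)^[n i] g)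
      (fun w => f (y, w)) l) = F at ih ⊢
    induction n i with
    | zero => exact ih
    | succ m hm =>
      simp only [Function.iterate_succ_apply']
      exact contDiff_partialZ i hm

/-! ### Coefficientwise smooth maps -/

/-- The basis chosen in `coeffwise` is immaterial: for an operation linear on the f j, any expansion
with constant vectors, not necessarily independent, may be used. -/
theorem coeffwise_sum_smul {X M ι : Type*} [AddCommGroup M] [Module ℂ M] [Module.Finite ℂ M]
    [Fintype ι] (T : (X → ℂ) → ℂ) (f : ι → X → ℂ) (c : ι → M)
    (hT : ∀ a : ι → ℂ, T (fun x => ∑ j, a j * f j x) = ∑ j, a j * T (f j)) :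
    coeffwise T (fun x => ∑ j, f j x • c j) = ∑ j, T (f j) • c j := by
  have h : ∀ k, T (fun x => (Module.finBasis ℂ M).repr (∑ j, f j x • c j) k) =
      ∑ j, (Module.finBasis ℂ M).repr (c j) k * T (f j) := fun k => by
    rw [← hT]
    congr 1
    ext x
    simp [mul_comm]
  simp only [coeffwise, h, Finset.sum_smul]
  rw [Finset.sum_comm]
  refine Finset.sum_congr rfl fun j _ => ?_
  conv_rhs => rw [← (Module.finBasis ℂ M).sum_repr (c j), Finset.smul_sum]
  refine Finset.sum_congr rfl fun k _ => ?_
  rw [smul_smul, mul_comm]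

section CoeffSmooth

variable {X : Type*} [NormedAddCommGroup X] [NormedSpace ℝ X]

/-- A map to a complex vector space is coefficientwise smooth if its composition with every linear
functional is smooth. -/
def CoeffSmooth {M : Type*} [AddCommGroup M] [Module ℂ M] (α : X → M) : Prop :=
  ∀ ℓ : M →ₗ[ℂ] ℂ, ContDiff ℝ ∞ fun p => ℓ (α p)

variable {M N : Type*} [AddCommGroup M] [Module ℂ M] [AddCommGroup N] [Module ℂ N]

theorem CoeffSmooth.const (c : M) : CoeffSmooth fun _ : X => c := fun _ => contDiff_const

theorem CoeffSmooth.sub {α β : X → M} (hα : CoeffSmooth α) (hβ : CoeffSmooth β) :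
    CoeffSmooth fun p => α p - β p := fun ℓ => by
  simpa only [map_sub] using (hα ℓ).sub (hβ ℓ)

theorem CoeffSmooth.sum {ι : Type*} {t : Finset ι} {α : ι → X → M}
    (hα : ∀ j ∈ t, CoeffSmooth (α j)) : CoeffSmooth fun p => ∑ j ∈ t, α j p := fun ℓ => by
  simpa only [map_sum] using ContDiff.sum fun j hj => hα j hj ℓ

theorem CoeffSmooth.smul {f : X → ℂ} {α : X → M} (hf : ContDiff ℝ ∞ f) (hα : CoeffSmooth α) :
    CoeffSmooth fun p => f p • α p := fun ℓ => by
  simpa only [map_smul, smul_eq_mul] using hf.mul (hα ℓ)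

theorem CoeffSmooth.linearMap_comp {α : X → M} (hα : CoeffSmooth α) (f : M →ₗ[ℂ] N) :
    CoeffSmooth fun p => f (α p) := fun ℓ => hα (ℓ.comp f)

theorem CoeffSmooth.comp {Y : Type*} [NormedAddCommGroup Y] [NormedSpace ℝ Y] {α : X → M}
    (hα : CoeffSmooth α) {f : Y → X} (hf : ContDiff ℝ ∞ f) : CoeffSmooth fun y => α (f y) :=
  fun ℓ => (hα ℓ).comp hf

theorem CoeffSmooth.mul {A : Type*} [Ring A] [Algebra ℂ A] [Module.Finite ℂ A] {α β : X → A}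
    (hα : CoeffSmooth α) (hβ : CoeffSmooth β) : CoeffSmooth fun p => α p * β p := by
  let b := Module.finBasis ℂ A
  have h : (fun p => α p * β p) = fun p => ∑ k, b.repr (α p) k • (b k * β p) := by
    ext p
    conv_lhs => rw [← b.sum_repr (α p), Finset.sum_mul]
    simp only [smul_mul_assoc]
  rw [h]
  exact CoeffSmooth.sum fun k _ => CoeffSmooth.smul (hα (b.coord k))
    (hβ.linearMap_comp (LinearMap.mulLeft ℂ (b k)))

theorem CoeffSmooth.list_prod {A ι : Type*} [Ring A] [Algebra ℂ A] [Module.Finite ℂ A]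
    {α : ι → X → A} (hα : ∀ j, CoeffSmooth (α j)) (l : List ι) :
    CoeffSmooth fun p => (l.map fun j => α j p).prod := by
  induction l with
  | nil => exact CoeffSmooth.const _
  | cons j l ih =>
    simp only [List.map_cons, List.prod_cons]
    exact (hα j).mul ih

end CoeffSmooth

/-! ### The propagator and its derivatives -/

theorem formPartialZ_sum_smul {d : ℕ} {ι : Type*} [Fintype ι] (i : Fin d) {f : ι → Cd d → ℂ}
    (hf : ∀ j, Differentiable ℝ (f j)) (c : ι → Ext (Cd d)) :
    formPartialZ i (fun z => ∑ j, f j z • c j) = fun z => ∑ j, partialZ i z (f j) • c j := by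
  ext z
  exact coeffwise_sum_smul (partialZ i z) f c fun a => partialZ_sum_mul i (fun j => hf j z) a

theorem contDiff_partialZ_slice {d : ℕ} (i : Fin d) {f : Cd d → ℂ} (hf : ContDiff ℝ ∞ f) :
    ContDiff ℝ ∞ fun z => partialZ i z f :=
  (contDiff_partialZ (Y := ℝ) i (hf.comp contDiff_snd)).comp (contDiff_const (c := 0).prodMk
    contDiff_id)

/-- A property that is stable under all `∂/∂z^i`, applied simultaneously to a form and to a family
of functions, is stable under `∂_{z^1}^{n_1} ⋯ ∂_{z^d}^{n_d}`. -/
theorem multiPartialZ_induction {d : ℕ} {ι : Type*} {P : Form (Cd d) → (ι → Cd d → ℂ) → Prop}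
    (hP : ∀ i α f, P α f → P (formPartialZ i α) fun j z => partialZ i z (f j))
    (n : Fin d → ℕ) {α : Form (Cd d)} {f : ι → Cd d → ℂ} (h : P α f) :
    P (formMultiPartialZ n α) fun j => multiPartialZ n (f j) := by
  have hiter : ∀ i (m : ℕ) {β F}, P β F →
      P ((formPartialZ i)^[m] β) fun j => (fun g z => partialZ i z g)^[m] (F j) := by
    intro i m β F hβ
    induction m with
    | zero => exact hβ
    | succ m hm =>
      simp only [Function.iterate_succ_apply']
      exact hP i _ _ hm
  unfold formMultiPartialZ multiPartialZ
  induction List.finRange d with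
  | nil => exact h
  | cons i l ih =>
    simp only [List.foldr_cons]
    exact hiter i _ ih

theorem formMultiPartialZ_sum_smul {d : ℕ} {ι : Type*} [Fintype ι] (n : Fin d → ℕ)
    {f : ι → Cd d → ℂ} (hf : ∀ j, ContDiff ℝ ∞ (f j)) (c : ι → Ext (Cd d)) :
    formMultiPartialZ n (fun z => ∑ j, f j z • c j) =
      fun z => ∑ j, multiPartialZ n (f j) z • c j := by
  refine (multiPartialZ_induction (P := fun α f => (∀ j, ContDiff ℝ ∞ (f j)) ∧
    α = fun z => ∑ j, f j z • c j) (fun i α f h => ⟨fun j => contDiff_partialZ_slice i (h.1 j), ?_⟩)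
    n ⟨hf, rfl⟩).2
  rw [h.2, formPartialZ_sum_smul i fun j => (h.1 j).differentiable (by simp)]

theorem multiPartialZ_sub {d : ℕ} (n : Fin d → ℕ) {f g : Cd d → ℂ} (hf : ContDiff ℝ ∞ f)
    (hg : ContDiff ℝ ∞ g) :
    multiPartialZ n (fun z => f z - g z) = fun z => multiPartialZ n f z - multiPartialZ n g z := by
  -- The functions f, g and f - g are differentiated together; the form slot plays no role and is
  -- filled with 0.
  refine (multiPartialZ_induction (ι := Fin 3) (f := ![f, g, fun z => f z - g z])
    (P := fun _ F => (ContDiff ℝ ∞ (F 0) ∧ ContDiff ℝ ∞ (F 1)) ∧ F 2 = fun z => F 0 z - F 1 z)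
    (fun i _ F h => ⟨⟨contDiff_partialZ_slice i h.1.1, contDiff_partialZ_slice i h.1.2⟩, ?_⟩)
    n (α := 0) ⟨⟨hf, hg⟩, rfl⟩).2
  ext z
  have := partialZ_sum_mul i (z := z) (f := ![F 0, F 1]) (fun j => by
    fin_cases j
    · exact h.1.1.differentiable (by simp) z
    · exact h.1.2.differentiable (by simp) z) ![1, -1]
  simpa [h.2, sub_eq_add_neg] using this

theorem dbarStar_heatKernel {d : ℕ} (t : ℝ) (z : Cd d) :
    dbarStar (heatKernel d t) z = ∑ i, (-2 * (1 / (2 * (Real.pi : ℂ) * t) ^ d *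
      Complex.exp (-(∑ j, z j * conj (z j)) / (2 * t)) * (-conj (z i) / (2 * t)))) •
        contractZbar i (ddzbar d) := by
  have hdiff : Differentiable ℝ fun w : Cd d => 1 / (2 * (Real.pi : ℂ) * t) ^ d *
      Complex.exp (-(∑ j, w j * conj (w j)) / (2 * t)) := by
    have hz : ∀ j, Differentiable ℝ fun w : Cd d => w j := fun j => differentiable_apply j
    have hc : ∀ j, Differentiable ℝ fun w : Cd d => conj (w j) := fun j =>
      Complex.conjCLE.differentiable.comp (hz j)
    have hs : Differentiable ℝ fun w : Cd d => ∑ j, w j * conj (w j) :=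
      Differentiable.fun_sum fun j _ => (hz j).fun_mul (hc j)
    simp only [div_eq_mul_inv]
    exact ((hs.fun_neg.mul_const _).cexp).const_mul _
  rw [dbarStar, Finset.smul_sum]
  refine Finset.sum_congr rfl fun i _ => ?_
  have h := congrFun (formPartialZ_sum_smul (ι := Unit) i (fun _ => hdiff)
    fun _ => contractZbar i (ddzbar d)) z
  simp only [Finset.univ_unique, Finset.sum_singleton] at h
  simp only [heatKernel, map_smul]
  rw [h, smul_smul, partialZ_heat]

theorem propagator_eq {d : ℕ} {ε L : ℝ} (hε : 0 < ε) (hL : 0 < L) :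
    propagator d ε L = fun z => ∑ i, (tailCoeff i ε⁻¹ z - tailCoeff i L⁻¹ z) •
      contractZbar i (ddzbar d) := by
  ext z
  unfold propagator
  simp only [dbarStar_heatKernel]
  rw [coeffwise_sum_smul]
  · simp only [integral_heatKernel_coeff _ z hε hL]
  · intro a
    rw [intervalIntegral.integral_finsetSum]
    · simp only [intervalIntegral.integral_const_mul]
    · exact fun i _ => (intervalIntegrable_heatKernel_coeff i z hε hL).const_mul _

/-! ### Signs in the exterior algebra -/

section Sign

variable {V V' : Type*} [AddCommGroup V] [Module ℂ V] [AddCommGroup V'] [Module ℂ V']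

/-- Moving an element of degree `k` of the exterior algebra to the left. -/
theorem mul_eq_mul_involute_pow {k : ℕ} {c : ExteriorAlgebra ℂ V}
    (hc : c ∈ LinearMap.range (ExteriorAlgebra.ι ℂ : V →ₗ[ℂ] ExteriorAlgebra ℂ V) ^ k)
    (x : ExteriorAlgebra ℂ V) :
    x * c = c * ((CliffordAlgebra.involute (Q := (0 : QuadraticForm ℂ V))).toLinearMap ^ k) x := by
  -- One covector passes any element, homogeneous or not, at the cost of the grade involution;
  -- degree k costs its k-th power.
  have hι : ∀ (v : V) (x : ExteriorAlgebra ℂ V), x * ExteriorAlgebra.ι ℂ v =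
      ExteriorAlgebra.ι ℂ v * CliffordAlgebra.involute (Q := (0 : QuadraticForm ℂ V)) x := by
    intro v x
    induction x using ExteriorAlgebra.induction with
    | algebraMap r =>
      rw [AlgHom.commutes, Algebra.commutes]
    | ι m =>
      have h1 : CliffordAlgebra.involute (Q := (0 : QuadraticForm ℂ V)) (ExteriorAlgebra.ι ℂ m) =
        -ExteriorAlgebra.ι ℂ m := CliffordAlgebra.involute_ι m
      rw [h1, mul_neg]
      exact eq_neg_of_add_eq_zero_left (ExteriorAlgebra.ι_add_mul_swap m v)
    | mul a b ha hb => rw [map_mul, mul_assoc, hb, ← mul_assoc, ha, mul_assoc]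
    | add a b ha hb => rw [map_add, add_mul, mul_add, ha, hb]
  induction k generalizing c x with
  | zero =>
    rw [pow_zero, Submodule.mem_one] at hc
    obtain ⟨r, rfl⟩ := hc
    simp [Algebra.commutes]
  | succ k ih =>
    rw [pow_succ] at hc
    refine Submodule.mul_induction_on hc ?_ fun a b ha hb => by rw [mul_add, add_mul, ha, hb]
    rintro a ha _ ⟨v, rfl⟩
    rw [← mul_assoc, ih ha, mul_assoc, hι, ← mul_assoc, pow_succ']
    rfl

/-- Contraction is an antiderivation of degree -1. For the empty list the truncated exponent is
harmless, because the contraction of 1 is zero. -/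
theorem contractLeft_list_prod_mem (f : Module.Dual ℂ V) (l : List V) :
    CliffordAlgebra.contractLeft (Q := (0 : QuadraticForm ℂ V)) f
        (l.map (ExteriorAlgebra.ι ℂ)).prod ∈
      LinearMap.range (ExteriorAlgebra.ι ℂ : V →ₗ[ℂ] ExteriorAlgebra ℂ V) ^ (l.length - 1) := by
  have hprod : ∀ l : List V, (l.map (ExteriorAlgebra.ι ℂ)).prod ∈
      LinearMap.range (ExteriorAlgebra.ι ℂ : V →ₗ[ℂ] ExteriorAlgebra ℂ V) ^ l.length := by
    intro l
    induction l with
    | nil => simp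
    | cons v l ih =>
      rw [List.map_cons, List.prod_cons, List.length_cons, pow_succ']
      exact Submodule.mul_mem_mul ⟨v, rfl⟩ ih
  induction l with
  | nil =>
    rw [List.map_nil, List.prod_nil, CliffordAlgebra.contractLeft_one]
    exact zero_mem _
  | cons v l ih =>
    have h := CliffordAlgebra.contractLeft_ι_mul (Q := (0 : QuadraticForm ℂ V)) f v
      (l.map (ExteriorAlgebra.ι ℂ)).prod
    rw [List.map_cons, List.prod_cons, List.length_cons, Nat.add_sub_cancel]
    refine h ▸ sub_mem (Submodule.smul_mem _ _ (hprod l)) ?_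
    cases l with
    | nil =>
      rw [List.map_nil, List.prod_nil, CliffordAlgebra.contractLeft_one, mul_zero]
      exact zero_mem _
    | cons w l =>
      rw [List.length_cons, pow_succ']
      exact Submodule.mul_mem_mul ⟨v, rfl⟩ ih

theorem map_mem_range_ι_pow (f : V →ₗ[ℂ] V') {k : ℕ} {c : ExteriorAlgebra ℂ V}
    (hc : c ∈ LinearMap.range (ExteriorAlgebra.ι ℂ : V →ₗ[ℂ] ExteriorAlgebra ℂ V) ^ k) :
    ExteriorAlgebra.map f c ∈
      LinearMap.range (ExteriorAlgebra.ι ℂ : V' →ₗ[ℂ] ExteriorAlgebra ℂ V') ^ k := by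
  have h : (LinearMap.range (ExteriorAlgebra.ι ℂ : V →ₗ[ℂ] ExteriorAlgebra ℂ V)).map
      (ExteriorAlgebra.map f).toLinearMap ≤
      LinearMap.range (ExteriorAlgebra.ι ℂ : V' →ₗ[ℂ] ExteriorAlgebra ℂ V') := by
    rintro _ ⟨_, ⟨v, rfl⟩, rfl⟩
    exact ⟨f v, (ExteriorAlgebra.map_apply_ι f v).symm⟩
  have h2 := Submodule.mem_map_of_mem (f := (ExteriorAlgebra.map f).toLinearMap) hc
  rw [Submodule.map_pow] at h2
  exact pow_le_pow_left' h k h2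

end Sign

theorem contractZbar_ddzbar_mem {d : ℕ} (i : Fin d) : contractZbar i (ddzbar d) ∈
    LinearMap.range (ExteriorAlgebra.ι ℂ : Cotangent (Cd d) →ₗ[ℂ] Ext (Cd d)) ^ (d - 1) := by
  have h := contractLeft_list_prod_mem (vecDzbar i) (List.ofFn fun i : Fin d => dzbar i)
  rwa [List.length_ofFn, List.map_ofFn] at h

/-! ### Edge factors -/

/-- The factor of an edge with head, tail and decoration `x` for the propagator between the times
`1 / s` and `+∞`. -/
def edgeTail {d N : ℕ} (x : Fin N × Fin N × (Fin d → ℕ)) (s : ℝ) : Form (Positions d N) :=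
  fun p => ∑ i, multiPartialZ x.2.2 (tailCoeff i s) (diffMap d x.1 x.2.1 p) •
    ExteriorAlgebra.map (LinearMap.lcomp ℂ ℂ (diffMap d x.1 x.2.1)) (contractZbar i (ddzbar d))

theorem coeffSmooth_edgeTail {d N : ℕ} (x : Fin N × Fin N × (Fin d → ℕ)) :
    CoeffSmooth fun q : ℝ × Positions d N => edgeTail x q.1 q.2 := by
  have hdiff : ContDiff ℝ ∞ fun q : ℝ × Positions d N => (q.1, diffMap d x.1 x.2.1 q.2) :=
    contDiff_fst.prodMk (((diffMap d x.1 x.2.1).toContinuousLinearMap.contDiff).comp contDiff_snd)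
  exact CoeffSmooth.sum fun i _ => CoeffSmooth.smul
    ((contDiff_multiPartialZ x.2.2 (contDiff_tailCoeff i)).comp hdiff) (CoeffSmooth.const _)

theorem edgeForm_eq {d : ℕ} (Γ : DecoratedGraph d) {ε L : ℝ} (hε : 0 < ε) (hL : 0 < L)
    (e : Fin Γ.numE) (p : Positions d Γ.numV) :
    edgeForm Γ ε L e p = edgeTail (Γ.head e, Γ.tail e, Γ.deco e) ε⁻¹ p -
      edgeTail (Γ.head e, Γ.tail e, Γ.deco e) L⁻¹ p := by
  have hs : ∀ i a, ContDiff ℝ ∞ (tailCoeff (d := d) i a) := fun i a =>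
    (contDiff_tailCoeff i).comp (contDiff_const.prodMk contDiff_id)
  rw [edgeForm, propagator_eq hε hL,
    formMultiPartialZ_sum_smul _ fun i => (hs i _).sub (hs i _), pullback]
  simp only [multiPartialZ_sub _ (hs _ _) (hs _ _), sub_smul, map_sub, map_sum, map_smul,
    Finset.sum_sub_distrib, edgeTail]

/-- Every edge factor has degree d - 1, whatever its decoration and cutoff, so the sign rule is the
same for all of them. -/
theorem mul_edgeTail {d N : ℕ} (x : Fin N × Fin N × (Fin d → ℕ)) (s : ℝ) (p : Positions d N)
    (y : Ext (Positions d N)) :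
    y * edgeTail x s p = edgeTail x s p * ((CliffordAlgebra.involute
      (Q := (0 : QuadraticForm ℂ (Cotangent (Positions d N))))).toLinearMap ^ (d - 1)) y :=
  mul_eq_mul_involute_pow (Submodule.sum_mem _ fun i _ => Submodule.smul_mem _ _
    (map_mem_range_ι_pow _ (contractZbar_ddzbar_mem i))) y

/-! ### Joint convergence -/

/-- The product of the edge factors of a list of edges, for the propagator between the times `1 / a`
and `1 / b`. -/
def edgeProd {d N : ℕ} (l : List (Fin N × Fin N × (Fin d → ℕ))) (a b : ℝ)
    (p : Positions d N) : Ext (Positions d N) :=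
  (l.map fun x => edgeTail x a p - edgeTail x b p).prod

theorem W_eq {d : ℕ} (Γ : DecoratedGraph d) {ε L : ℝ} (hε : 0 < ε) (hL : 0 < L)
    (Φ : Form (Positions d Γ.numV)) :
    W Γ ε L Φ = (-1) ^ ((d - 1) * (Γ.numE * (Γ.numE - 1) / 2) + Γ.numE) *
      ∫ p, topCoeff d Γ.numV (edgeProd (List.ofFn fun e => (Γ.head e, Γ.tail e, Γ.deco e)) ε⁻¹ L⁻¹ p *
        Φ p) := by
  simp only [W, integrate, edgeForm_eq Γ hε hL, edgeProd, List.map_ofFn]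
  rfl

section

variable {d N : ℕ}

theorem coeffSmooth_edgeProd {X : Type*} [NormedAddCommGroup X] [NormedSpace ℝ X]
    (l : List (Fin N × Fin N × (Fin d → ℕ))) {a b : X → ℝ} {p : X → Positions d N}
    (ha : ContDiff ℝ ∞ a) (hb : ContDiff ℝ ∞ b) (hp : ContDiff ℝ ∞ p) :
    CoeffSmooth fun q => edgeProd l (a q) (b q) (p q) :=
  CoeffSmooth.list_prod (fun x => ((coeffSmooth_edgeTail x).comp (ha.prodMk hp)).sub
    ((coeffSmooth_edgeTail x).comp (hb.prodMk hp))) l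

/-- The map σ is linear and independent of cutoffs and position. A smooth correction moved past the
singular edges therefore remains smooth and independent of ε. -/
theorem exists_mul_edgeProd (l : List (Fin N × Fin N × (Fin d → ℕ))) :
    ∃ σ : Ext (Positions d N) →ₗ[ℂ] Ext (Positions d N), ∀ a b p y,
      y * edgeProd l a b p = edgeProd l a b p * σ y := by
  induction l with
  | nil => exact ⟨LinearMap.id, fun a b p y => by simp [edgeProd]⟩
  | cons x l ih =>
    obtain ⟨σ, hσ⟩ := ih
    refine ⟨σ ∘ₗ (CliffordAlgebra.involute
      (Q := (0 : QuadraticForm ℂ (Cotangent (Positions d N))))).toLinearMap ^ (d - 1),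
      fun a b p y => ?_⟩
    have hσ' := hσ a b p
    simp only [edgeProd, List.map_cons, List.prod_cons] at hσ' ⊢
    rw [← mul_assoc, mul_sub, mul_edgeTail, mul_edgeTail, ← sub_mul, mul_assoc, hσ', mul_assoc]
    rfl

theorem integrable_topCoeff {α : Form (Positions d N)} (hα : CoeffSmooth α) {K : Set (Positions d N)}
    (hK : IsCompact K) (hsupp : ∀ p ∉ K, α p = 0) : Integrable fun p => topCoeff d N (α p) :=
  (hα _).continuous.integrable_of_hasCompactSupport
    (HasCompactSupport.intro hK fun p hp => by rw [hsupp p hp, map_zero])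

/-- Expanding Φ in a basis of the exterior algebra reduces the claim to scalar densities, to which
the uniform boundedness result applies. -/
theorem exists_tendsto_integral_edgeProd {L : ℝ} (hL : 0 < L)
    (h : ∀ (Γ : DecoratedGraph d) (Φ : Form (Positions d Γ.numV)), IsTestForm Φ → W0LExists Γ L Φ)
    (l : List (Fin N × Fin N × (Fin d → ℕ))) {Φ : ℝ × Positions d N → Ext (Positions d N)}
    (hΦ : CoeffSmooth Φ) {K : Set (Positions d N)} (hK : IsCompact K)
    (hsupp : ∀ s p, p ∉ K → Φ (s, p) = 0) :
    ∃ w, Tendsto (fun q : ℝ × ℝ => ∫ p, topCoeff d N (edgeProd l q.1⁻¹ L⁻¹ p * Φ (q.2, p)))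
      (𝓝[>] 0 ×ˢ 𝓝 0) (𝓝 w) := by
  let b := Module.finBasis ℂ (Ext (Positions d N))
  -- The hypothesis is used for the graph on the same vertices whose edges are exactly those of l.
  let Γ : DecoratedGraph d := ⟨N, l.length, fun e => (l.get e).2.1, fun e => (l.get e).1,
    fun e => (l.get e).2.2⟩
  have hlist : (List.ofFn fun e => (Γ.head e, Γ.tail e, Γ.deco e)) = l := List.ofFn_get l
  have hsm : ∀ ε : ℝ, CoeffSmooth fun p => edgeProd l ε⁻¹ L⁻¹ p := fun ε =>
    coeffSmooth_edgeProd l contDiff_const contDiff_const contDiff_id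
  have hlim : ∀ k, ∃ w, Tendsto (fun q : ℝ × ℝ =>
      ∫ p, topCoeff d N (edgeProd l q.1⁻¹ L⁻¹ p * b k) * b.repr (Φ (q.2, p)) k)
      (𝓝[>] 0 ×ˢ 𝓝 0) (𝓝 w) := by
    intro k
    refine exists_tendsto_integral_mul_family (f := fun q => b.repr (Φ q) k)
      (u := fun ε p => topCoeff d N (edgeProd l ε⁻¹ L⁻¹ p * b k))
      (fun ε _ => (((hsm ε).mul (CoeffSmooth.const (b k))) _).continuous)
      (fun φ hφ hφc => ?_) (hΦ (b.coord k)) hK fun s p hp => by simp [hsupp s p hp]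
    obtain ⟨w, hw⟩ := h Γ (fun p => φ p • b k) ⟨CoeffSmooth.smul hφ (CoeffSmooth.const _),
      HasCompactSupport.intro hφc fun p hp => by
        rw [image_eq_zero_of_notMem_tsupport hp, zero_smul]⟩
    refine ⟨_, (hw.const_mul
      ((-1) ^ ((d - 1) * (Γ.numE * (Γ.numE - 1) / 2) + Γ.numE))).congr' ?_⟩
    filter_upwards [self_mem_nhdsWithin] with ε hε
    -- The sign prefactor is its own inverse, so multiplying by it again leaves the bare integral.
    rw [W_eq Γ hε hL, hlist, ← mul_assoc, ← mul_pow, neg_one_mul, neg_neg, one_pow, one_mul]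
    refine integral_congr_ae (.of_forall fun p => ?_)
    simp only [mul_smul_comm, map_smul, smul_eq_mul]
    exact mul_comm _ _
  choose w hw using hlim
  refine ⟨∑ k, w k, (tendsto_finsetSum Finset.univ fun k _ => hw k).congr fun q => ?_⟩
  rw [← integral_finsetSum]
  · refine integral_congr_ae (.of_forall fun p => ?_)
    beta_reduce
    conv_rhs => rw [← b.sum_repr (Φ (q.2, p))]
    simp only [Finset.mul_sum, mul_smul_comm, map_sum, map_smul, smul_eq_mul]
    exact Finset.sum_congr rfl fun k _ => mul_comm _ _
  · intro k _
    have hc : Continuous fun p => b.repr (Φ (q.2, p)) k :=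
      (hΦ (b.coord k)).continuous.comp (by fun_prop)
    refine ((((hsm q.1).mul (CoeffSmooth.const (b k))) _).continuous.mul
      hc).integrable_of_hasCompactSupport (HasCompactSupport.intro hK fun p hp => ?_)
    simp [hsupp _ p hp]

/-- Replacing the upper time limit `L` by `1 / s` in the edge factors of `l₁`, one edge at a time,
keeps the joint convergence. -/
theorem exists_tendsto_integral_edgeProd_mul_edgeProd {L : ℝ} (hL : 0 < L)
    (h : ∀ (Γ : DecoratedGraph d) (Φ : Form (Positions d Γ.numV)), IsTestForm Φ → W0LExists Γ L Φ)
    (l₁ l₂ : List (Fin N × Fin N × (Fin d → ℕ))) {Φ : ℝ × Positions d N → Ext (Positions d N)}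
    (hΦ : CoeffSmooth Φ) {K : Set (Positions d N)} (hK : IsCompact K)
    (hsupp : ∀ s p, p ∉ K → Φ (s, p) = 0) :
    ∃ w, Tendsto (fun q : ℝ × ℝ => ∫ p, topCoeff d N
      (edgeProd l₁ q.1⁻¹ q.2 p * (edgeProd l₂ q.1⁻¹ L⁻¹ p * Φ (q.2, p))))
      (𝓝[>] 0 ×ˢ 𝓝 0) (𝓝 w) := by
  induction l₁ using List.reverseRecOn generalizing l₂ Φ with
  | nil => simpa [edgeProd] using exists_tendsto_integral_edgeProd hL h l₂ hΦ hK hsupp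
  | append_singleton l₁ x ih =>
    obtain ⟨σ, hσ⟩ := exists_mul_edgeProd (d := d) (N := N) l₂
    -- The factor of x with cutoff 1/s is the one with cutoff L plus this correction. The first
    -- summand joins l₂, the second is carried past the edges of l₂ by σ and absorbed into the test
    -- form.
    let Ψ : ℝ × Positions d N → Ext (Positions d N) := fun q =>
      σ (edgeTail x L⁻¹ q.2 - edgeTail x q.1 q.2) * Φ q
    have hΨ : CoeffSmooth Ψ := ((((coeffSmooth_edgeTail x).comp
      (contDiff_const.prodMk contDiff_snd)).sub (coeffSmooth_edgeTail x)).linearMap_comp σ).mul hΦ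
    have hΨsupp : ∀ s p, p ∉ K → Ψ (s, p) = 0 := fun s p hp => by simp [Ψ, hsupp s p hp]
    obtain ⟨w₁, hw₁⟩ := ih (x :: l₂) hΦ hsupp
    obtain ⟨w₂, hw₂⟩ := ih l₂ hΨ hΨsupp
    refine ⟨_, (hw₁.add hw₂).congr fun q => ?_⟩
    have hint : ∀ (l : List (Fin N × Fin N × (Fin d → ℕ)))
        {Θ : ℝ × Positions d N → Ext (Positions d N)}, CoeffSmooth Θ →
        (∀ s p, p ∉ K → Θ (s, p) = 0) → Integrable fun p => topCoeff d N
          (edgeProd l₁ q.1⁻¹ q.2 p * (edgeProd l q.1⁻¹ L⁻¹ p * Θ (q.2, p))) := by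
      intro l Θ hΘ hΘsupp
      refine integrable_topCoeff (CoeffSmooth.mul (coeffSmooth_edgeProd _ contDiff_const
        contDiff_const contDiff_id) (CoeffSmooth.mul (coeffSmooth_edgeProd _ contDiff_const
        contDiff_const contDiff_id) (hΘ.comp (contDiff_const.prodMk contDiff_id)))) hK
        fun p hp => by simp [hΘsupp _ p hp]
    rw [← integral_add (hint _ hΦ hsupp) (hint _ hΨ hΨsupp)]
    refine integral_congr_ae (.of_forall fun p => ?_)
    beta_reduce
    rw [← map_add]
    congr 1
    have h₁ : edgeProd (l₁ ++ [x]) q.1⁻¹ q.2 p =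
        edgeProd l₁ q.1⁻¹ q.2 p * (edgeTail x q.1⁻¹ p - edgeTail x q.2 p) := by simp [edgeProd]
    have h₂ : edgeProd (x :: l₂) q.1⁻¹ L⁻¹ p =
        (edgeTail x q.1⁻¹ p - edgeTail x L⁻¹ p) * edgeProd l₂ q.1⁻¹ L⁻¹ p := by simp [edgeProd]
    rw [h₁, h₂, ← mul_add, mul_assoc (edgeProd l₁ _ _ _) (_ - _)]
    congr 1
    simp only [Ψ]
    rw [← mul_assoc (edgeProd l₂ _ _ _), ← hσ, ← add_mul, ← add_mul, sub_add_sub_cancel, mul_assoc]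

end

end FeynmanGraph

end

theorem mainTheorem8 (d : ℕ) (hd : 1 ≤ d) (L : ℝ) (hL : 0 < L)
    (h : ∀ (Γ : FeynmanGraph.DecoratedGraph d)
      (Φ : FeynmanGraph.Form (FeynmanGraph.Positions d Γ.numV)),
      FeynmanGraph.IsTestForm Φ → FeynmanGraph.W0LExists Γ L Φ)
    (Γ : FeynmanGraph.DecoratedGraph d)
    (Φ : FeynmanGraph.Form (FeynmanGraph.Positions d Γ.numV))
    (hΦ : FeynmanGraph.IsTestForm Φ) :
    FeynmanGraph.W0InftyExists Γ Φ := by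
  obtain ⟨w, hw⟩ := FeynmanGraph.exists_tendsto_integral_edgeProd_mul_edgeProd hL h
    (List.ofFn fun e => (Γ.head e, Γ.tail e, Γ.deco e)) [] (Φ := fun q => Φ q.2)
    (FeynmanGraph.CoeffSmooth.comp hΦ.1 contDiff_snd) hΦ.2
    fun s p hp => image_eq_zero_of_notMem_tsupport hp
  -- With s = 1/L the point L = +∞ becomes s = 0, an interior point of the smooth family.
  have hinv : Tendsto (fun q : ℝ × ℝ => (q.1, q.2⁻¹)) (𝓝[>] 0 ×ˢ atTop) (𝓝[>] 0 ×ˢ 𝓝 0) :=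
    tendsto_fst.prodMk (tendsto_inv_atTop_zero.comp tendsto_snd)
  refine ⟨_, ((hw.comp hinv).const_mul
    ((-1) ^ ((d - 1) * (Γ.numE * (Γ.numE - 1) / 2) + Γ.numE))).congr' ?_⟩
  filter_upwards [prod_mem_prod self_mem_nhdsWithin (Ioi_mem_atTop (0 : ℝ))] with q hq
  rw [FeynmanGraph.W_eq Γ hq.1 hq.2]
  simp [FeynmanGraph.edgeProd]
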